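/- Consider finitely many users $i\in\mathcal I$ and finitely many providers $j\in\mathcal J$. Provider $j$ has $Q_j>0$ units of resource. The channel offsets $c_{ij}$ are independent, almost surely positive real random variables whose distributions are continuous (have no atoms). Each utility $u_i:[0,\infty)\to\mathbb R$ is continuous, increasing, strictly concave, and differentiable (at $0$ the one-sided derivative may be infinite, as for $u(x)=x^{1-\alpha}/(1-\alpha)$, $0<\alpha<1$). For a demand vector $\boldsymbol q_i=(q_{ij})_j$ of user $i$ put $x_i(\boldsymbol q_i)=\sum_j c_{ij}q_{ij}$ and $f_{ij}(\boldsymbol q_i)=c_{ij}\,u_i'(x_i(\boldsymbol q_i))$. An equilibrium $(\boldsymbol q^*,\boldsymbol p^*)$ consists of a maximizer $\boldsymbol q^*$ of the social welfare $\sum_i u_i(x_i(\boldsymbol q_i))$ over all $\boldsymbol q\ge 0$ with $\sum_i q_{ij}=Q_j$ for every $j$, and an associated vector $\boldsymbol p^*$ of Lagrange multipliers of the resource constraints, that is, $u_i'(x_i(\boldsymbol q_i^*))$ is finite, $f_{ij}(\boldsymbol q_i^*)\le p_j^*$ and $q_{ij}^*\,(f_{ij}(\boldsymbol q_i^*)-p_j^*)=0$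 for all $i,j$. User $i$ is decided at the equilibrium if $q^*_{ij}>0$ for at most one $j$; provider $j$ has user $i$ as a decided user if $i$ is decided and $q_{ij}^*>0$. Write $(x)^+_y=x$ if $y>0$ and $(x)^+_y=\max(0,x)$ if $y\le 0$. For update rates $k^q_{ij}>0$ and $k^p_j>0$, the primal–dual dynamics is $$\dot q_{ij}=k^q_{ij}\,\bigl(f_{ij}(\boldsymbol q_i)-p_j\bigr)^+_{q_{ij}},\qquad \dot p_j=k^p_j\,\Bigl(\sum_i q_{ij}-Q_j\Bigr)^+_{p_j}\qquad(i\in\mathcal I,\ j\in\mathcal J).$$ A solution trajectory is a pair of locally absolutely continuous functions $\boldsymbol q(t),\boldsymbol p(t)$ on $[0,\infty)$ with $\boldsymbol q(0)\ge 0$ and $\boldsymbol p(0)\ge 0$ such that, for almost every $t>0$, the marginal utilities $f_{ij}(\boldsymbol q_i(t))$ are finite and the equations hold. Theorem. With probability $1$ over the offsets $c_{ij}$, for every equilibrium $(\boldsymbol q^*,\boldsymbol p^*)$, all positive update rates and every solution trajectory $(\boldsymbol q(t),\boldsymbol p(t))$: (a) for every user $i$ that is decided at the equilibrium, $\lim_{t\to\infty}\boldsymbol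 q_i(t)=\boldsymbol q_i^*$; (b) for every provider $j$ that has at least one decided user at the equilibrium, $\lim_{t\to\infty}p_j(t)=p_j^*$. -/

import Mathlib

noncomputable section

namespace ProviderCompetition

variable {I J : Type*} [Fintype I] [Fintype J]

/-- A utility function on `[0, ∞)`: continuous, increasing, strictly concave, and differentiable.
The (right) derivative at the endpoint `0` is allowed to be infinite, as it is for the
`α`-fair utilities `x ^ (1 - α) / (1 - α)`. Values at negative reals are irrelevant. -/
structure IsUtility (u : ℝ → ℝ) : Prop where
  continuousOn : ContinuousOn u (Set.Ici 0)
  differentiableOn : DifferentiableOn ℝ u (Set.Ioi 0)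
  strictMonoOn : StrictMonoOn u (Set.Ici 0)
  strictConcaveOn : StrictConcaveOn ℝ (Set.Ici 0) u

/-- Effective resource `x = ∑ j, q j * c j` of a user with channel offsets `c` and demand
vector `q`. -/
def effective (c q : J → ℝ) : ℝ := ∑ j, q j * c j

/-- The derivative of the utility `u` at `x` exists as a real number (one-sided at `x = 0`). -/
def HasMarginal (u : ℝ → ℝ) (x : ℝ) : Prop := DifferentiableWithinAt ℝ u (Set.Ici 0) x

/-- Marginal utility `f j = c j * u' (x)`, `x = ∑ k, q k * c k`, of a user with respect to its
demand from provider `j`. -/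
def marginal (u : ℝ → ℝ) (c q : J → ℝ) (j : J) : ℝ :=
  c j * derivWithin u (Set.Ici 0) (effective c q)

/-- Feasible demands of the social welfare problem: nonnegative, and all resources are sold. -/
structure IsFeasible (Q : J → ℝ) (q : I → J → ℝ) : Prop where
  nonneg : ∀ i j, 0 ≤ q i j
  clearing : ∀ j, ∑ i, q i j = Q j

/-- Social welfare `∑ i, u i (x i)`. -/
def welfare (u : I → ℝ → ℝ) (c q : I → J → ℝ) : ℝ := ∑ i, u i (effective (c i) (q i))

/-- `q` maximizes the social welfare over the feasible demands. -/
structure IsSWOMaximizer (u : I → ℝ → ℝ) (Q : J → ℝ) (c q : I → J → ℝ) : Prop where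
  feasible : IsFeasible Q q
  maximal : ∀ q' : I → J → ℝ, IsFeasible Q q' → welfare u c q' ≤ welfare u c q

/-- `p` is a Lagrange multiplier vector for the resource constraints at the demand `q`:
stationarity and complementary slackness with respect to `0 ≤ q`. -/
structure IsMultiplier (u : I → ℝ → ℝ) (c q : I → J → ℝ) (p : J → ℝ) : Prop where
  hasMarginal : ∀ i, HasMarginal (u i) (effective (c i) (q i))
  stationary : ∀ i j, marginal (u i) (c i) (q i) j - p j ≤ 0
  slackness : ∀ i j, q i j * (marginal (u i) (c i) (q i) j - p j) = 0

/-- The equilibrium: a socially optimal demand vector with an associated multiplier vector. -/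
structure IsEquilibrium (u : I → ℝ → ℝ) (Q : J → ℝ) (c q : I → J → ℝ) (p : J → ℝ) : Prop where
  maximizer : IsSWOMaximizer u Q c q
  multiplier : IsMultiplier u c q p

/-- A user is decided when it demands a positive amount from at most one provider. -/
def IsDecided (q : J → ℝ) : Prop := {j | 0 < q j}.ncard ≤ 1

/-- The operation `(x)⁺_y`: `x` if `y > 0`, and `max 0 x` if `y ≤ 0`. -/
def gatedPos (x y : ℝ) : ℝ := if 0 < y then x else max 0 x

/-- Solution trajectories on `[0, ∞)` of the primal-dual dynamics with update rates `kq`, `kp`,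
started at nonnegative demands and prices. As the right-hand side is discontinuous, solutions are
understood in the sense of Carathéodory: locally absolutely continuous functions that satisfy the
differential equations at almost every time. -/
structure IsTrajectory (u : I → ℝ → ℝ) (Q : J → ℝ) (c : I → J → ℝ) (kq : I → J → ℝ) (kp : J → ℝ)
    (q : ℝ → I → J → ℝ) (p : ℝ → J → ℝ) : Prop where
  q_init : ∀ i j, 0 ≤ q 0 i j
  p_init : ∀ j, 0 ≤ p 0 j
  q_ac : ∀ i j, ∀ T, 0 ≤ T → AbsolutelyContinuousOnInterval (fun t => q t i j) 0 T
  p_ac : ∀ j, ∀ T, 0 ≤ T → AbsolutelyContinuousOnInterval (fun t => p t j) 0 T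
  hasMarginal : ∀ᵐ t : ℝ, 0 < t → ∀ i, HasMarginal (u i) (effective (c i) (q t i))
  q_deriv : ∀ᵐ t : ℝ, 0 < t → ∀ i j, HasDerivAt (fun s => q s i j)
    (kq i j * gatedPos (marginal (u i) (c i) (q t i) j - p t j) (q t i j)) t
  p_deriv : ∀ᵐ t : ℝ, 0 < t → ∀ j, HasDerivAt (fun s => p s j)
    (kp j * gatedPos (∑ i, q t i j - Q j) (p t j)) t

end ProviderCompetition

end

/-! The proof has a deterministic half and a generic half, joined by strict complementarity: at the
equilibrium every unused link has `f < p*`. Deterministic half: the weighted squared distance to the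
equilibrium is nonincreasing along trajectories. Its rate of decrease dominates each concavity gap
`(u'(x*) - u'(x)) * (x - x*)` and each slackness term `(p* - f*) * q`. A one-sided Barbalat argument
then gives `x_i → x_i*` for every user (`tendsto_effective`) and `q_ij → 0` on links with strict
slack (`tendsto_zero_of_inactive`). A decided user has at most one active link, so its demand is
recovered from `x_i`. Where that demand is positive, the equation `q' = k * (f - p)` with `q`
convergent and `f → p*` forces `p → p*`. Generic half: fix all offsets but one. The optimal welfare
is monotone in the remaining one. If a link is unused but tight, its offset is exactly the point
where the welfare leaves its value at offset zero. At most one number has this property, and an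
independent atomless variable misses it almost surely. The criterion involves only the optimal
welfare, so one null set serves all equilibria. -/

section

open Set Filter Topology MeasureTheory ProbabilityTheory

namespace ProviderCompetition

/-! ### Marginal utilities of strictly concave functions -/

section Utility

variable {u : ℝ → ℝ} {a x y : ℝ}

lemma IsUtility.hasMarginal (hu : IsUtility u) (hx : 0 < x) : HasMarginal u x :=
  (hu.differentiableOn.differentiableAt (Ioi_mem_nhds hx)).differentiableWithinAt

lemma IsUtility.derivWithin_lt (hu : IsUtility u) (hx : 0 ≤ x) (hxy : x < y)
    (hm : HasMarginal u x) : derivWithin u (Ici 0) y < derivWithin u (Ici 0) x :=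
  (hu.strictConcaveOn.derivWithin_lt_slope hx (hx.trans hxy.le) hxy
    (hu.hasMarginal (hx.trans_lt hxy))).trans
    (hu.strictConcaveOn.slope_lt_derivWithin hx (hx.trans hxy.le) hxy hm)

lemma IsUtility.derivWithin_pos (hu : IsUtility u) (hx : 0 ≤ x) (hm : HasMarginal u x) :
    0 < derivWithin u (Ici 0) x := by
  have hx1 : x + 1 ∈ Ici (0 : ℝ) := by simp only [mem_Ici]; linarith
  refine lt_trans ?_ (hu.strictConcaveOn.slope_lt_derivWithin hx hx1 (lt_add_one x) hm)
  rw [slope_def_field]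
  have := hu.strictMonoOn hx hx1 (lt_add_one x)
  exact div_pos (by linarith) (by linarith)

lemma IsUtility.marginal_gap_nonneg (hu : IsUtility u) (ha : 0 ≤ a) (hma : HasMarginal u a)
    (hx : 0 ≤ x) (hmx : HasMarginal u x) :
    0 ≤ (derivWithin u (Ici 0) a - derivWithin u (Ici 0) x) * (x - a) := by
  rcases lt_trichotomy x a with h | h | h
  · exact mul_nonneg_of_nonpos_of_nonpos
      (by linarith [hu.derivWithin_lt hx h hmx]) (by linarith)
  · simp [h]
  · exact mul_nonneg (by linarith [hu.derivWithin_lt ha h hma]) (by linarith)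

/-- The derivative is strictly decreasing, so comparison with one fixed point on each side of `a`
gives a gap uniform in `x`. The left point is `a - ε / 2`, usable only if positive; otherwise no `x
≥ 0` lies `ε` to the left of `a`. -/
lemma IsUtility.exists_marginal_gap (hu : IsUtility u) (ha : 0 ≤ a) (hma : HasMarginal u a)
    {ε : ℝ} (hε : 0 < ε) : ∃ δ > 0, ∀ x, 0 ≤ x → HasMarginal u x → ε ≤ |x - a| →
      δ ≤ (derivWithin u (Ici 0) a - derivWithin u (Ici 0) x) * (x - a) := by
  set D := derivWithin u (Ici 0) with hD
  have hup : 0 < D a - D (a + ε) := by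
    linarith [hu.derivWithin_lt ha (show a < a + ε by linarith) hma]
  have right : ∀ x, a + ε ≤ x → ε * (D a - D (a + ε)) ≤ (D a - D x) * (x - a) := by
    intro x hx
    have : D x ≤ D (a + ε) := by
      rcases hx.eq_or_lt with h | h
      · rw [h]
      · exact (hu.derivWithin_lt (by linarith) h (hu.hasMarginal (by linarith))).le
    rw [mul_comm]
    exact mul_le_mul (by linarith) (by linarith) hε.le (by linarith)
  by_cases hl : 0 < a - ε / 2
  · have hdn : 0 < D (a - ε / 2) - D a := by
      linarith [hu.derivWithin_lt hl.le (show a - ε / 2 < a by linarith) (hu.hasMarginal hl)]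
    refine ⟨min (ε * (D a - D (a + ε))) (ε * (D (a - ε / 2) - D a)),
      lt_min (mul_pos hε hup) (mul_pos hε hdn), fun x hx hmx h => ?_⟩
    rcases le_abs.1 h with h | h
    · exact (min_le_left _ _).trans (right x (by linarith))
    · refine (min_le_right _ _).trans ?_
      have := hu.derivWithin_lt hx (show x < a - ε / 2 by linarith) hmx
      have h2 : (D a - D x) * (x - a) = (a - x) * (D x - D a) := by ring
      rw [h2]
      exact mul_le_mul (by linarith) (by linarith) hdn.le (by linarith)
  · refine ⟨ε * (D a - D (a + ε)), mul_pos hε hup, fun x hx hmx h => ?_⟩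
    rcases le_abs.1 h with h | h
    · exact right x (by linarith)
    · linarith

/-- Secant slopes trap the derivative of a concave function: choose `b` near `a` with the slope from
`a` to `b` close to `u'(a)`, then move `a` to `x` with `b` fixed. At `a = 0` monotonicity replaces
the missing left secant. -/
lemma IsUtility.continuousWithinAt_derivWithin (hu : IsUtility u) (hma : HasMarginal u a) (ha : 0 ≤ a) :
    ContinuousWithinAt (derivWithin u (Ici 0)) {x | 0 ≤ x ∧ HasMarginal u x} a := by
  set D := derivWithin u (Ici 0) with hD
  have hslope : Tendsto (slope u a) (𝓝[Ici 0 \ {a}] a) (𝓝 (D a)) :=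
    hasDerivWithinAt_iff_tendsto_slope.1 hma.hasDerivWithinAt
  have hcont : ∀ b, b ≠ a → ContinuousWithinAt (fun x => slope u x b) (Ici 0) a := by
    intro b hb
    simp only [slope_def_field]
    exact (continuousWithinAt_const.sub (hu.continuousOn a ha)).div
      (continuousWithinAt_const.sub continuousWithinAt_id) (sub_ne_zero.2 hb)
  have hsub : {x | 0 ≤ x ∧ HasMarginal u x} ⊆ Ici 0 := fun x hx => hx.1
  have hmem : ∀ᶠ x in 𝓝[{x | 0 ≤ x ∧ HasMarginal u x}] a, 0 ≤ x ∧ HasMarginal u x :=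
    self_mem_nhdsWithin
  refine tendsto_order.2 ⟨fun l hl => ?_, fun l hl => ?_⟩
  · have h1 : ∀ᶠ b in 𝓝[>] a, l < slope u a b :=
      (hslope.mono_left (nhdsWithin_mono a fun b (hb : a < b) =>
        ⟨ha.trans hb.le, hb.ne'⟩)).eventually (lt_mem_nhds hl)
    obtain ⟨b, hlb, hab⟩ := (h1.and self_mem_nhdsWithin).exists
    replace hab : a < b := hab
    have h2 := ((hcont b hab.ne').mono hsub).eventually (lt_mem_nhds hlb)
    filter_upwards [h2, hmem, mem_nhdsWithin_of_mem_nhds (Iio_mem_nhds hab)] with x h3 hx hxb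
    exact h3.trans (hu.strictConcaveOn.slope_lt_derivWithin hx.1 (ha.trans hab.le) hxb hx.2)
  · rcases ha.eq_or_lt with h0 | h0
    · filter_upwards [hmem] with x hx
      rcases hx.1.eq_or_lt with h | h
      · rwa [← h, h0]
      · subst h0
        exact (hu.derivWithin_lt le_rfl h hma).trans hl
    · have h1 : ∀ᶠ b in 𝓝[Ioo 0 a] a, slope u a b < l :=
        (hslope.mono_left (nhdsWithin_mono a fun b (hb : b ∈ Ioo 0 a) =>
          ⟨hb.1.le, hb.2.ne⟩)).eventually (gt_mem_nhds hl)
      have : (𝓝[Ioo 0 a] a).NeBot := by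
        rw [nhdsWithin_Ioo_eq_nhdsLT h0]; infer_instance
      obtain ⟨b, hlb, hb⟩ := (h1.and self_mem_nhdsWithin).exists
      have h2 := ((hcont b hb.2.ne).mono hsub).eventually (gt_mem_nhds
        (show slope u a b < l from hlb))
      filter_upwards [h2, hmem, mem_nhdsWithin_of_mem_nhds (Ioi_mem_nhds hb.2)] with x h3 hx hxb
      rw [slope_comm] at h3
      exact (hu.strictConcaveOn.derivWithin_lt_slope hb.1.le hx.1 hxb hx.2).trans h3

end Utility

end ProviderCompetition

/-! ### Differential inequalities and Barbalat arguments for absolutely continuous functions -/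

section AbsolutelyContinuous

variable {f g V : ℝ → ℝ}

lemma AbsolutelyContinuousOnInterval.mul_sub_le_sub {a b m : ℝ}
    (hf : AbsolutelyContinuousOnInterval f a b) (hab : a ≤ b)
    (hd : ∀ᵐ t : ℝ, t ∈ Ioo a b → ∃ d, m ≤ d ∧ HasDerivAt f d t) :
    m * (b - a) ≤ f b - f a := by
  rw [← hf.integral_deriv_eq_sub]
  have h : ∫ _ in a..b, m = m * (b - a) := by simp [mul_comm]
  rw [← h]
  refine intervalIntegral.integral_mono_ae_restrict hab (by simp)
    hf.intervalIntegrable_deriv ?_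
  rw [restrict_Ioo_eq_restrict_Icc.symm]
  refine (ae_restrict_iff' measurableSet_Ioo).2 ?_
  filter_upwards [hd] with t ht hmem
  obtain ⟨d, hmd, hd⟩ := ht hmem
  rwa [hd.deriv]

/-- Local absolute continuity on `[0, ∞)`. -/
def LocallyAC (f : ℝ → ℝ) : Prop := ∀ T, 0 ≤ T → AbsolutelyContinuousOnInterval f 0 T

lemma AbsolutelyContinuousOnInterval.const (k a b : ℝ) :
    AbsolutelyContinuousOnInterval (fun _ => k) a b :=
  (LipschitzWith.const k).lipschitzOnWith.absolutelyContinuousOnInterval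

lemma LocallyAC.const (k : ℝ) : LocallyAC fun _ => k :=
  fun _ _ => AbsolutelyContinuousOnInterval.const k _ _

lemma LocallyAC.add (hf : LocallyAC f) (hg : LocallyAC g) : LocallyAC fun t => f t + g t :=
  fun T hT => (hf T hT).add (hg T hT)

lemma LocallyAC.sub (hf : LocallyAC f) (hg : LocallyAC g) : LocallyAC fun t => f t - g t :=
  fun T hT => (hf T hT).sub (hg T hT)

lemma LocallyAC.neg (hf : LocallyAC f) : LocallyAC fun t => - f t :=
  fun T hT => (hf T hT).neg

lemma LocallyAC.mul (hf : LocallyAC f) (hg : LocallyAC g) : LocallyAC fun t => f t * g t :=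
  fun T hT => (hf T hT).mul (hg T hT)

lemma LocallyAC.sum {ι : Type*} (s : Finset ι) {F : ι → ℝ → ℝ} (hF : ∀ i, LocallyAC (F i)) :
    LocallyAC fun t => ∑ i ∈ s, F i t := by
  classical
  induction s using Finset.induction_on with
  | empty => simpa using LocallyAC.const 0
  | insert i s hi ih => simpa [Finset.sum_insert hi] using (hF i).add ih

lemma LocallyAC.mul_sub_le_sub {a b m : ℝ} (hf : LocallyAC f) (ha : 0 ≤ a) (hab : a ≤ b)
    (hd : ∀ᵐ t : ℝ, t ∈ Ioo a b → ∃ d, m ≤ d ∧ HasDerivAt f d t) :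
    m * (b - a) ≤ f b - f a := by
  refine ((hf b (ha.trans hab)).mono ?_).mul_sub_le_sub hab hd
  rw [uIcc_of_le hab, uIcc_of_le (ha.trans hab)]
  exact Icc_subset_Icc_left ha

lemma LocallyAC.sub_le_mul_sub {a b m : ℝ} (hf : LocallyAC f) (ha : 0 ≤ a) (hab : a ≤ b)
    (hd : ∀ᵐ t : ℝ, t ∈ Ioo a b → ∃ d, d ≤ m ∧ HasDerivAt f d t) :
    f b - f a ≤ m * (b - a) := by
  have := hf.neg.mul_sub_le_sub (m := -m) ha hab (by
    filter_upwards [hd] with t ht hmem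
    obtain ⟨d, h1, h2⟩ := ht hmem
    exact ⟨-d, by linarith, h2.neg⟩)
  linarith

lemma LocallyAC.continuousOn (hf : LocallyAC f) {T : ℝ} (hT : 0 ≤ T) :
    ContinuousOn f (Icc 0 T) := by
  simpa [uIcc_of_le hT] using (hf T hT).continuousOn

/-- Nonnegativity is preserved when the derivative is nonnegative at negative values. -/
lemma LocallyAC.nonneg (hf : LocallyAC f) (h0 : 0 ≤ f 0)
    (hd : ∀ᵐ t : ℝ, 0 < t → f t < 0 → ∃ d, 0 ≤ d ∧ HasDerivAt f d t) {t : ℝ} (ht : 0 ≤ t) :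
    0 ≤ f t := by
  by_contra! hneg
  have hcl : IsClosed (Icc 0 t ∩ f ⁻¹' Ici 0) :=
    (hf.continuousOn ht).preimage_isClosed_of_isClosed isClosed_Icc isClosed_Ici
  have hcomp : IsCompact (Icc 0 t ∩ f ⁻¹' Ici 0) :=
    isCompact_Icc.of_isClosed_subset hcl inter_subset_left
  -- `s` is the last time up to `t` with `f s ≥ 0`; after it `f` is negative, hence nondecreasing.
  obtain ⟨s, ⟨⟨hs0, hst⟩, hfs⟩, hmax⟩ := hcomp.exists_isGreatest ⟨0, ⟨le_rfl, ht⟩, h0⟩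
  have := hf.mul_sub_le_sub (m := 0) hs0 hst (by
    filter_upwards [hd] with r hr hmem
    refine hr (hs0.trans_lt hmem.1) ?_
    by_contra! hfr
    exact absurd (hmax ⟨⟨hs0.trans hmem.1.le, hmem.2.le⟩, hfr⟩) (not_le.2 hmem.1))
  simp only [mem_preimage, mem_Ici] at hfs
  linarith

/-- A convergent function cannot decrease at a definite rate on windows of fixed length that occur
arbitrarily late. -/
lemma LocallyAC.eventually_exists_not (hV : LocallyAC V) {l : ℝ} (hl : Tendsto V atTop (𝓝 l))
    {S : ℝ → Prop} {δ h : ℝ} (hδ : 0 < δ) (hh : 0 < h)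
    (hd : ∀ᵐ t : ℝ, 0 < t → S t → ∃ d, d ≤ -δ ∧ HasDerivAt V d t) :
    ∀ᶠ t in atTop, ∃ s ∈ Ioo t (t + h), ¬ S s := by
  have h1 : Tendsto (fun t => V (t + h) - V t) atTop (𝓝 0) := by
    simpa using (hl.comp (tendsto_atTop_add_const_right atTop h tendsto_id)).sub hl
  filter_upwards [h1.eventually (lt_mem_nhds (show -(δ * h) < 0 by nlinarith)),
    eventually_ge_atTop 0] with t ht ht0
  by_contra! hS
  have := hV.sub_le_mul_sub (m := -δ) ht0 (show t ≤ t + h by linarith) (by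
    filter_upwards [hd] with s hs hmem
    exact hs (ht0.trans_lt hmem.1) (hS s hmem))
  nlinarith

lemma LocallyAC.exists_tendsto (hV : LocallyAC V) (hV0 : ∀ t, 0 ≤ t → 0 ≤ V t)
    (hd : ∀ᵐ t : ℝ, 0 < t → ∃ d, d ≤ 0 ∧ HasDerivAt V d t) :
    (∀ t, 0 ≤ t → V t ≤ V 0) ∧ ∃ l, Tendsto V atTop (𝓝 l) := by
  have hanti : ∀ a b, 0 ≤ a → a ≤ b → V b ≤ V a := by
    intro a b ha hab
    have := hV.sub_le_mul_sub (m := 0) ha hab (by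
      filter_upwards [hd] with t ht hmem using ht (ha.trans_lt hmem.1))
    linarith
  refine ⟨fun t ht => hanti 0 t le_rfl ht, ?_⟩
  have h1 : Antitone fun t => V (max t 0) := fun a b hab =>
    hanti _ _ (le_max_right _ _) (max_le_max_right 0 hab)
  have h2 : BddBelow (range fun t => V (max t 0)) :=
    ⟨0, by rintro _ ⟨t, rfl⟩; exact hV0 _ (le_max_right _ _)⟩
  refine ⟨_, (tendsto_atTop_ciInf h1 h2).congr' ?_⟩
  filter_upwards [eventually_ge_atTop 0] with t ht
  rw [max_eq_left ht]

/-- A one-sided form of Barbalat's lemma: if the convergent function `V` decreases at a definite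
rate while `g` is away from zero, and `g` does not decrease too fast, then `g` tends to zero. -/
lemma LocallyAC.tendsto_zero (hV : LocallyAC V) {l : ℝ} (hl : Tendsto V atTop (𝓝 l))
    (hg : LocallyAC g) {K : ℝ} (hK : ∀ᵐ t : ℝ, 0 < t → ∃ d, -K ≤ d ∧ HasDerivAt g d t)
    (hd : ∀ ε > 0, ∃ δ > 0, ∀ᵐ t : ℝ, 0 < t → ε ≤ |g t| → ∃ d, d ≤ -δ ∧ HasDerivAt V d t) :
    Tendsto g atTop (𝓝 0) := by
  have hlip : ∀ a b, 0 ≤ a → a ≤ b → -(|K| + 1) * (b - a) ≤ g b - g a := by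
    intro a b ha hab
    refine hg.mul_sub_le_sub ha hab ?_
    filter_upwards [hK] with t ht hmem
    obtain ⟨d, h1, h2⟩ := ht (ha.trans_lt hmem.1)
    exact ⟨d, by linarith [le_abs_self K], h2⟩
  have hK1 : 0 < |K| + 1 := by positivity
  rw [Metric.tendsto_atTop']
  intro ε hε
  obtain ⟨δ, hδ, hd⟩ := hd (ε / 2) (by positivity)
  -- Over a window of length `h` the function `g` drops by at most `ε / 2`. A point with `|g| < ε /
  -- 2` just after `t` bounds `g t` from above, and one just before `t` bounds it from below.
  set h := ε / (2 * (|K| + 1)) with hh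
  have hKh : (|K| + 1) * h = ε / 2 := by rw [hh]; field_simp
  have hh0 : 0 < h := by positivity
  have hev := hV.eventually_exists_not hl hδ hh0 hd
  have hev' := (tendsto_atTop_add_const_right atTop (-h) tendsto_id).eventually hev
  obtain ⟨N, hN⟩ := eventually_atTop.1 (hev.and (hev'.and (eventually_ge_atTop h)))
  refine ⟨N, fun t ht => ?_⟩
  obtain ⟨⟨s, hs, hgs⟩, ⟨r, hr, hgr⟩, hth⟩ := hN t ht.le
  simp only [id] at hr
  rw [Real.dist_eq, sub_zero]
  rw [not_le, abs_lt] at hgs hgr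
  have e1 := hlip t s (by linarith) hs.1.le
  have e2 := hlip r t (by linarith [hr.1]) (by linarith [hr.2])
  have e3 : (|K| + 1) * (s - t) ≤ ε / 2 := by
    rw [← hKh]; exact mul_le_mul_of_nonneg_left (by linarith [hs.2]) hK1.le
  have e4 : (|K| + 1) * (t - r) ≤ ε / 2 := by
    rw [← hKh]; exact mul_le_mul_of_nonneg_left (by linarith [hr.1]) hK1.le
  rw [abs_lt]
  constructor <;> nlinarith

/-- If `y` converges, `y' = k * (w - p)` eventually with `w → 0`, and `p` is Lipschitz, then `p → 0`.
-/
lemma LocallyAC.tendsto_zero_of_deriv {y w p : ℝ → ℝ} {l k K : ℝ} (hk : 0 < k)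
    (hy : LocallyAC y) (hl : Tendsto y atTop (𝓝 l)) (hp : LocallyAC p)
    (hK : ∀ᵐ t : ℝ, 0 < t → ∃ d, |d| ≤ K ∧ HasDerivAt p d t)
    (hw : ∀ ε > 0, ∃ T, ∀ᵐ t : ℝ, T < t → |w t| < ε)
    (hd : ∃ T, ∀ᵐ t : ℝ, T < t → HasDerivAt y (k * (w t - p t)) t) :
    Tendsto p atTop (𝓝 0) := by
  obtain ⟨T₁, hd⟩ := hd
  have hlip : ∀ a b, 0 ≤ a → a ≤ b → -(|K| + 1) * (b - a) ≤ p b - p a ∧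
      p b - p a ≤ (|K| + 1) * (b - a) := by
    intro a b ha hab
    constructor
    · refine hp.mul_sub_le_sub ha hab ?_
      filter_upwards [hK] with t ht hmem
      obtain ⟨d, h1, h2⟩ := ht (ha.trans_lt hmem.1)
      exact ⟨d, by linarith [le_abs_self K, neg_abs_le d], h2⟩
    · refine hp.sub_le_mul_sub ha hab ?_
      filter_upwards [hK] with t ht hmem
      obtain ⟨d, h1, h2⟩ := ht (ha.trans_lt hmem.1)
      exact ⟨d, by linarith [le_abs_self K, le_abs_self d], h2⟩
  have hK1 : 0 < |K| + 1 := by positivity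
  rw [Metric.tendsto_atTop']
  intro ε hε
  obtain ⟨T₂, hw⟩ := hw (ε / 4) (by positivity)
  set h := ε / (2 * (|K| + 1)) with hh
  have hKh : (|K| + 1) * h = ε / 2 := by rw [hh]; field_simp
  have hh0 : 0 < h := by positivity
  have hδ : 0 < k * (ε / 4) := by positivity
  -- Where `p ≥ ε / 2` and `|w| < ε / 4`, `y` falls at rate at least `k * (ε / 4)`, which a
  -- convergent `y` cannot sustain over late windows. `dn` is the mirror image for `-y`.
  have up := hy.eventually_exists_not hl (S := fun t => max T₁ T₂ < t ∧ ε / 2 ≤ p t) hδ hh0 (by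
    filter_upwards [hw, hd] with t h1 h2 _ hS
    have hT := max_lt_iff.1 hS.1
    refine ⟨_, ?_, h2 hT.1⟩
    have := abs_lt.1 (h1 hT.2)
    nlinarith [hS.2])
  have dn := hy.neg.eventually_exists_not hl.neg
    (S := fun t => max T₁ T₂ < t ∧ p t ≤ - (ε / 2)) hδ hh0 (by
    filter_upwards [hw, hd] with t h1 h2 _ hS
    have hT := max_lt_iff.1 hS.1
    refine ⟨_, ?_, (h2 hT.1).neg⟩
    have := abs_lt.1 (h1 hT.2)
    nlinarith [hS.2])
  obtain ⟨N, hN⟩ := eventually_atTop.1 (up.and (dn.and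
    ((eventually_ge_atTop (max T₁ T₂)).and (eventually_ge_atTop 0))))
  refine ⟨N, fun t ht => ?_⟩
  obtain ⟨⟨s, hs, hgs⟩, ⟨r, hr, hgr⟩, htT, ht0⟩ := hN t ht.le
  have hs2 : p s < ε / 2 := by
    by_contra! hc; exact hgs ⟨htT.trans_lt hs.1, hc⟩
  have hr2 : - (ε / 2) < p r := by
    by_contra! hc; exact hgr ⟨htT.trans_lt hr.1, hc⟩
  have e1 := (hlip t s ht0 hs.1.le).1
  have e2 := (hlip t r ht0 hr.1.le).2
  have e3 : (|K| + 1) * (s - t) ≤ ε / 2 := by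
    rw [← hKh]; exact mul_le_mul_of_nonneg_left (by linarith [hs.2]) hK1.le
  have e4 : (|K| + 1) * (r - t) ≤ ε / 2 := by
    rw [← hKh]; exact mul_le_mul_of_nonneg_left (by linarith [hr.2]) hK1.le
  rw [Real.dist_eq, sub_zero, abs_lt]
  constructor <;> nlinarith

end AbsolutelyContinuous

namespace ProviderCompetition

/-! ### The gated positive part -/

section Gate

variable {x y z : ℝ}

lemma le_gatedPos : x ≤ gatedPos x y := by
  unfold gatedPos
  split_ifs
  · exact le_rfl
  · exact le_max_right _ _

lemma gatedPos_of_pos (hy : 0 < y) : gatedPos x y = x := if_pos hy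

lemma gatedPos_nonneg (hy : y ≤ 0) : 0 ≤ gatedPos x y := by
  rw [gatedPos, if_neg (not_lt.2 hy)]
  exact le_max_left _ _

lemma abs_gatedPos_le : |gatedPos x y| ≤ |x| := by
  unfold gatedPos
  split_ifs
  · exact le_rfl
  · rw [abs_of_nonneg (le_max_left _ _)]
    exact max_le (abs_nonneg _) (le_abs_self _)

/-- The gate acts only at `y = 0`, where it raises `x` while `y - z ≤ 0`: projection can only help
the Lyapunov function decrease. -/
lemma sub_mul_gatedPos_le (hy : 0 ≤ y) (hz : 0 ≤ z) :
    (y - z) * gatedPos x y ≤ (y - z) * x := by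
  rcases hy.eq_or_lt with h | h
  · subst h
    exact mul_le_mul_of_nonpos_left le_gatedPos (by linarith)
  · rw [gatedPos_of_pos h]

end Gate

/-! ### Lyapunov analysis and convergence under strict complementarity -/

section Dynamics

variable {I J : Type*} [Fintype I] [Fintype J] {u : I → ℝ → ℝ} {Q : J → ℝ} {c : I → J → ℝ}
  {qs : I → J → ℝ} {ps : J → ℝ} {kq : I → J → ℝ} {kp : J → ℝ} {q : ℝ → I → J → ℝ} {p : ℝ → J → ℝ}

lemma effective_nonneg {c q : J → ℝ} (hc : ∀ j, 0 < c j) (hq : ∀ j, 0 ≤ q j) :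
    0 ≤ effective c q :=
  Finset.sum_nonneg fun j _ => mul_nonneg (hq j) (hc j).le

lemma IsTrajectory.q_nonneg (h : IsTrajectory u Q c kq kp q p) (hkq : ∀ i j, 0 < kq i j)
    {t : ℝ} (ht : 0 ≤ t) (i : I) (j : J) : 0 ≤ q t i j := by
  refine LocallyAC.nonneg (f := fun t => q t i j) (h.q_ac i j) (h.q_init i j) ?_ ht
  filter_upwards [h.q_deriv] with s hs hs0 hneg
  exact ⟨_, mul_nonneg (hkq i j).le (gatedPos_nonneg hneg.le), hs hs0 i j⟩

lemma IsTrajectory.p_nonneg (h : IsTrajectory u Q c kq kp q p) (hkp : ∀ j, 0 < kp j)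
    {t : ℝ} (ht : 0 ≤ t) (j : J) : 0 ≤ p t j := by
  refine LocallyAC.nonneg (f := fun t => p t j) (h.p_ac j) (h.p_init j) ?_ ht
  filter_upwards [h.p_deriv] with s hs hs0 hneg
  exact ⟨_, mul_nonneg (hkp j).le (gatedPos_nonneg hneg.le), hs hs0 j⟩

lemma IsEquilibrium.price_nonneg (hu : ∀ i, IsUtility (u i)) (hQ : ∀ j, 0 < Q j)
    (hc : ∀ i j, 0 < c i j) (hE : IsEquilibrium u Q c qs ps) (j : J) : 0 ≤ ps j := by
  have hfeas := hE.maximizer.feasible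
  obtain ⟨i, -, -⟩ : ∃ i ∈ Finset.univ, 0 < qs i j := by
    by_contra! hcon
    exact absurd (hfeas.clearing j ▸ Finset.sum_nonpos hcon) (not_le.2 (hQ j))
  have h1 := hE.multiplier.stationary i j
  have h2 : 0 < marginal (u i) (c i) (qs i) j :=
    mul_pos (hc i j) ((hu i).derivWithin_pos (effective_nonneg (hc i) (hfeas.nonneg i))
      (hE.multiplier.hasMarginal i))
  linarith

/-- The quadratic Lyapunov function of the primal-dual dynamics. -/
noncomputable def lyapunov (kq : I → J → ℝ) (kp : J → ℝ) (qs : I → J → ℝ) (ps : J → ℝ)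
    (q : I → J → ℝ) (p : J → ℝ) : ℝ :=
  (∑ i, ∑ j, (2 * kq i j)⁻¹ * ((q i j - qs i j) * (q i j - qs i j))) +
    ∑ j, (2 * kp j)⁻¹ * ((p j - ps j) * (p j - ps j))

/-- The guaranteed rate of decrease of the Lyapunov function. -/
noncomputable def dissipation (u : I → ℝ → ℝ) (c qs : I → J → ℝ) (ps : J → ℝ) (q : I → J → ℝ) : ℝ :=
  (∑ i, (derivWithin (u i) (Ici 0) (effective (c i) (qs i)) -
      derivWithin (u i) (Ici 0) (effective (c i) (q i))) *
      (effective (c i) (q i) - effective (c i) (qs i))) +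
    ∑ i, ∑ j, (ps j - marginal (u i) (c i) (qs i) j) * q i j

lemma lyapunov_nonneg (hkq : ∀ i j, 0 < kq i j) (hkp : ∀ j, 0 < kp j) (q : I → J → ℝ)
    (p : J → ℝ) : 0 ≤ lyapunov kq kp qs ps q p := by
  refine add_nonneg (Finset.sum_nonneg fun i _ => Finset.sum_nonneg fun j _ => ?_)
    (Finset.sum_nonneg fun j _ => ?_)
  · have := hkq i j
    exact mul_nonneg (by positivity) (mul_self_nonneg _)
  · have := hkp j
    exact mul_nonneg (by positivity) (mul_self_nonneg _)

lemma q_term_le_lyapunov (hkq : ∀ i j, 0 < kq i j) (hkp : ∀ j, 0 < kp j) (q : I → J → ℝ)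
    (p : J → ℝ) (i : I) (j : J) :
    (2 * kq i j)⁻¹ * ((q i j - qs i j) * (q i j - qs i j)) ≤ lyapunov kq kp qs ps q p := by
  have h1 : ∀ i j, 0 ≤ (2 * kq i j)⁻¹ * ((q i j - qs i j) * (q i j - qs i j)) := fun i j =>
    mul_nonneg (by have := hkq i j; positivity) (mul_self_nonneg _)
  have h2 : ∀ j, 0 ≤ (2 * kp j)⁻¹ * ((p j - ps j) * (p j - ps j)) := fun j =>
    mul_nonneg (by have := hkp j; positivity) (mul_self_nonneg _)
  have h3 := Finset.single_le_sum (fun j _ => h1 i j) (Finset.mem_univ j)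
  have h4 := Finset.single_le_sum (f := fun i => ∑ j, (2 * kq i j)⁻¹ *
    ((q i j - qs i j) * (q i j - qs i j)))
    (fun i _ => Finset.sum_nonneg fun j _ => h1 i j) (Finset.mem_univ i)
  exact (h3.trans h4).trans (le_add_of_nonneg_right (Finset.sum_nonneg fun j _ => h2 j))

lemma p_term_le_lyapunov (hkq : ∀ i j, 0 < kq i j) (hkp : ∀ j, 0 < kp j) (q : I → J → ℝ)
    (p : J → ℝ) (j : J) :
    (2 * kp j)⁻¹ * ((p j - ps j) * (p j - ps j)) ≤ lyapunov kq kp qs ps q p := by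
  have h1 : ∀ i j, 0 ≤ (2 * kq i j)⁻¹ * ((q i j - qs i j) * (q i j - qs i j)) := fun i j =>
    mul_nonneg (by have := hkq i j; positivity) (mul_self_nonneg _)
  have h2 : ∀ j, 0 ≤ (2 * kp j)⁻¹ * ((p j - ps j) * (p j - ps j)) := fun j =>
    mul_nonneg (by have := hkp j; positivity) (mul_self_nonneg _)
  have h3 := Finset.single_le_sum (fun j _ => h2 j) (Finset.mem_univ j)
  exact h3.trans (le_add_of_nonneg_left
    (Finset.sum_nonneg fun i _ => Finset.sum_nonneg fun j _ => h1 i j))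

lemma abs_le_of_mul_sub_sq_le {k a b v : ℝ} (hk : 0 < k)
    (h : (2 * k)⁻¹ * ((a - b) * (a - b)) ≤ v) : |a| ≤ |b| + (2 * k * v + 1) := by
  have h1 : (a - b) * (a - b) ≤ 2 * k * v := by
    rwa [inv_mul_le_iff₀ (by positivity)] at h
  have h2 : |a - b| ≤ (a - b) * (a - b) + 1 := by
    rw [← abs_mul_abs_self (a - b)]
    nlinarith [sq_nonneg (|a - b| - 1), abs_nonneg (a - b)]
  have h3 := abs_sub_abs_le_abs_sub a b
  linarith

/-- Market clearing turns the price sum into `(p - p*) * (q - q*)`, which replaces `p` by `p*` in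
the demand sum. Splitting `f - p*` at the equilibrium and using `q* * (f* - p*) = 0` leaves the two
dissipation sums. -/
lemma dissipation_identity (hE : IsEquilibrium u Q c qs ps) (q : I → J → ℝ) (p : J → ℝ) :
    (∑ i, ∑ j, (q i j - qs i j) * (marginal (u i) (c i) (q i) j - p j)) +
      ∑ j, (p j - ps j) * (∑ i, q i j - Q j) = - dissipation u c qs ps q := by
  have h1 : ∑ j, (p j - ps j) * (∑ i, q i j - Q j) =
      ∑ i, ∑ j, (p j - ps j) * (q i j - qs i j) := by
    rw [Finset.sum_comm]
    refine Finset.sum_congr rfl fun j _ => ?_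
    rw [← Finset.mul_sum, Finset.sum_sub_distrib, hE.maximizer.feasible.clearing j]
  rw [h1, dissipation, neg_add, ← Finset.sum_neg_distrib, ← Finset.sum_neg_distrib,
    ← Finset.sum_add_distrib, ← Finset.sum_add_distrib]
  refine Finset.sum_congr rfl fun i _ => ?_
  simp only [effective]
  rw [← Finset.sum_sub_distrib, Finset.mul_sum, ← Finset.sum_neg_distrib, ← Finset.sum_neg_distrib,
    ← Finset.sum_add_distrib, ← Finset.sum_add_distrib]
  refine Finset.sum_congr rfl fun j _ => ?_
  have := hE.multiplier.slackness i j
  simp only [marginal, effective] at this ⊢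
  linear_combination -this

lemma HasDerivAt.inv_two_mul_sq {y : ℝ → ℝ} {k g t : ℝ} (hk : 0 < k) (b : ℝ)
    (hy : HasDerivAt y (k * g) t) :
    HasDerivAt (fun s => (2 * k)⁻¹ * ((y s - b) * (y s - b))) ((y t - b) * g) t := by
  have h := ((hy.sub_const b).mul (hy.sub_const b)).const_mul (2 * k)⁻¹
  refine h.congr_deriv ?_
  field_simp
  ring

lemma IsTrajectory.lyapunov_deriv (hu : ∀ i, IsUtility (u i)) (hQ : ∀ j, 0 < Q j)
    (hc : ∀ i j, 0 < c i j) (hE : IsEquilibrium u Q c qs ps) (hkq : ∀ i j, 0 < kq i j)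
    (hkp : ∀ j, 0 < kp j) (h : IsTrajectory u Q c kq kp q p) :
    ∀ᵐ t : ℝ, 0 < t → ∃ d, d ≤ - dissipation u c qs ps (q t) ∧
      HasDerivAt (fun t => lyapunov kq kp qs ps (q t) (p t)) d t := by
  filter_upwards [h.q_deriv, h.p_deriv] with t hq hp ht
  refine ⟨_, ?_, HasDerivAt.fun_add
    (HasDerivAt.fun_sum fun i _ => HasDerivAt.fun_sum fun j _ =>
      HasDerivAt.inv_two_mul_sq (hkq i j) (qs i j) (hq ht i j))
    (HasDerivAt.fun_sum fun j _ => HasDerivAt.inv_two_mul_sq (hkp j) (ps j) (hp ht j))⟩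
  rw [← dissipation_identity hE (q t) (p t)]
  refine add_le_add (Finset.sum_le_sum fun i _ => Finset.sum_le_sum fun j _ => ?_)
    (Finset.sum_le_sum fun j _ => ?_)
  · exact sub_mul_gatedPos_le (h.q_nonneg hkq ht.le i j) (hE.maximizer.feasible.nonneg i j)
  · exact sub_mul_gatedPos_le (h.p_nonneg hkp ht.le j) (hE.price_nonneg hu hQ hc j)

lemma IsTrajectory.lyapunov_locallyAC (h : IsTrajectory u Q c kq kp q p) :
    LocallyAC fun t => lyapunov kq kp qs ps (q t) (p t) := by
  refine .add (.sum _ fun i => .sum _ fun j => .mul (.const _) ?_)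
    (.sum _ fun j => .mul (.const _) ?_)
  · have : LocallyAC fun t => q t i j - qs i j := .sub (h.q_ac i j) (.const _)
    exact this.mul this
  · have : LocallyAC fun t => p t j - ps j := .sub (h.p_ac j) (.const _)
    exact this.mul this

lemma gap_term_le_dissipation (hu : ∀ i, IsUtility (u i)) (hc : ∀ i j, 0 < c i j)
    (hE : IsEquilibrium u Q c qs ps) {q : I → J → ℝ} (hq : ∀ i j, 0 ≤ q i j)
    (hm : ∀ i, HasMarginal (u i) (effective (c i) (q i))) :
    (∀ i, (derivWithin (u i) (Ici 0) (effective (c i) (qs i)) -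
      derivWithin (u i) (Ici 0) (effective (c i) (q i))) *
      (effective (c i) (q i) - effective (c i) (qs i)) ≤ dissipation u c qs ps q) ∧
    (∀ i j, (ps j - marginal (u i) (c i) (qs i) j) * q i j ≤ dissipation u c qs ps q) ∧
    0 ≤ dissipation u c qs ps q := by
  have h1 : ∀ i, 0 ≤ (derivWithin (u i) (Ici 0) (effective (c i) (qs i)) -
      derivWithin (u i) (Ici 0) (effective (c i) (q i))) *
      (effective (c i) (q i) - effective (c i) (qs i)) := fun i =>
    (hu i).marginal_gap_nonneg (effective_nonneg (hc i) (hE.maximizer.feasible.nonneg i))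
      (hE.multiplier.hasMarginal i) (effective_nonneg (hc i) (hq i)) (hm i)
  have h2 : ∀ i j, 0 ≤ (ps j - marginal (u i) (c i) (qs i) j) * q i j := fun i j =>
    mul_nonneg (by linarith [hE.multiplier.stationary i j]) (hq i j)
  have h3 : ∀ i, 0 ≤ ∑ j, (ps j - marginal (u i) (c i) (qs i) j) * q i j :=
    fun i => Finset.sum_nonneg fun j _ => h2 i j
  refine ⟨fun i => ?_, fun i j => ?_, ?_⟩
  · exact (Finset.single_le_sum (fun i _ => h1 i) (Finset.mem_univ i)).trans
      (le_add_of_nonneg_right (Finset.sum_nonneg fun i _ => h3 i))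
  · exact ((Finset.single_le_sum (fun j _ => h2 i j) (Finset.mem_univ j)).trans
      (Finset.single_le_sum (fun i _ => h3 i) (Finset.mem_univ i))).trans
      (le_add_of_nonneg_left (Finset.sum_nonneg fun i _ => h1 i))
  · exact add_nonneg (Finset.sum_nonneg fun i _ => h1 i) (Finset.sum_nonneg fun i _ => h3 i)

lemma IsTrajectory.lyapunov_tendsto (hu : ∀ i, IsUtility (u i)) (hQ : ∀ j, 0 < Q j)
    (hc : ∀ i j, 0 < c i j) (hE : IsEquilibrium u Q c qs ps) (hkq : ∀ i j, 0 < kq i j)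
    (hkp : ∀ j, 0 < kp j) (h : IsTrajectory u Q c kq kp q p) :
    (∀ t, 0 ≤ t → lyapunov kq kp qs ps (q t) (p t) ≤ lyapunov kq kp qs ps (q 0) (p 0)) ∧
      ∃ l, Tendsto (fun t => lyapunov kq kp qs ps (q t) (p t)) atTop (𝓝 l) := by
  refine h.lyapunov_locallyAC.exists_tendsto (fun t _ => lyapunov_nonneg hkq hkp _ _) ?_
  filter_upwards [h.lyapunov_deriv hu hQ hc hE hkq hkp, h.hasMarginal] with t h1 h2 ht
  obtain ⟨d, hd, hV⟩ := h1 ht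
  have := (gap_term_le_dissipation hu hc hE (h.q_nonneg hkq ht.le) (h2 ht)).2.2
  exact ⟨d, by linarith, hV⟩

lemma IsTrajectory.bounded (hu : ∀ i, IsUtility (u i)) (hQ : ∀ j, 0 < Q j)
    (hc : ∀ i j, 0 < c i j) (hE : IsEquilibrium u Q c qs ps) (hkq : ∀ i j, 0 < kq i j)
    (hkp : ∀ j, 0 < kp j) (h : IsTrajectory u Q c kq kp q p) :
    (∃ B : I → J → ℝ, ∀ t, 0 ≤ t → ∀ i j, |q t i j| ≤ B i j) ∧
      ∃ B : J → ℝ, ∀ t, 0 ≤ t → ∀ j, |p t j| ≤ B j := by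
  have hV := (h.lyapunov_tendsto hu hQ hc hE hkq hkp).1
  exact ⟨⟨_, fun t ht i j => abs_le_of_mul_sub_sq_le (hkq i j)
    ((q_term_le_lyapunov hkq hkp (q t) (p t) i j).trans (hV t ht))⟩,
    ⟨_, fun t ht j => abs_le_of_mul_sub_sq_le (hkp j)
    ((p_term_le_lyapunov hkq hkp (q t) (p t) j).trans (hV t ht))⟩⟩

/-- Only a lower bound is available: prices are bounded and marginal utilities positive, but the
latter may blow up near zero. Hence the one-sided form of `LocallyAC.tendsto_zero`. -/
lemma IsTrajectory.q_deriv_lower (hu : ∀ i, IsUtility (u i)) (hQ : ∀ j, 0 < Q j)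
    (hc : ∀ i j, 0 < c i j) (hE : IsEquilibrium u Q c qs ps) (hkq : ∀ i j, 0 < kq i j)
    (hkp : ∀ j, 0 < kp j) (h : IsTrajectory u Q c kq kp q p) :
    ∃ K : I → J → ℝ, ∀ᵐ t : ℝ, 0 < t → ∀ i j, ∃ d, -K i j ≤ d ∧
      HasDerivAt (fun s => q s i j) d t := by
  obtain ⟨-, B, hB⟩ := h.bounded hu hQ hc hE hkq hkp
  refine ⟨fun i j => kq i j * B j, ?_⟩
  filter_upwards [h.q_deriv, h.hasMarginal] with t h1 h2 ht i j
  refine ⟨_, ?_, h1 ht i j⟩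
  have h3 : 0 < marginal (u i) (c i) (q t i) j :=
    mul_pos (hc i j) ((hu i).derivWithin_pos (effective_nonneg (hc i) (h.q_nonneg hkq ht.le i))
      (h2 ht i))
  have h4 := abs_le.1 (hB t ht.le j)
  have h5 := le_gatedPos (x := marginal (u i) (c i) (q t i) j - p t j) (y := q t i j)
  rw [← mul_neg]
  exact mul_le_mul_of_nonneg_left (by linarith) (hkq i j).le

lemma IsTrajectory.tendsto_effective (hu : ∀ i, IsUtility (u i)) (hQ : ∀ j, 0 < Q j)
    (hc : ∀ i j, 0 < c i j) (hE : IsEquilibrium u Q c qs ps) (hkq : ∀ i j, 0 < kq i j)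
    (hkp : ∀ j, 0 < kp j) (h : IsTrajectory u Q c kq kp q p) (i : I) :
    Tendsto (fun t => effective (c i) (q t i)) atTop (𝓝 (effective (c i) (qs i))) := by
  obtain ⟨-, l, hl⟩ := h.lyapunov_tendsto hu hQ hc hE hkq hkp
  obtain ⟨K, hK⟩ := h.q_deriv_lower hu hQ hc hE hkq hkp
  have hac : LocallyAC fun t => effective (c i) (q t i) - effective (c i) (qs i) :=
    .sub (.sum _ fun j => .mul (h.q_ac i j) (.const _)) (.const _)
  rw [← tendsto_sub_nhds_zero_iff]
  refine h.lyapunov_locallyAC.tendsto_zero hl hac (K := ∑ j, K i j * c i j) ?_ ?_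
  · filter_upwards [hK] with t hK ht
    choose d hd1 hd2 using fun j => hK ht i j
    refine ⟨∑ j, d j * c i j, ?_, (HasDerivAt.fun_sum fun j _ =>
      (hd2 j).mul_const (c i j)).sub_const _⟩
    rw [← Finset.sum_neg_distrib]
    refine Finset.sum_le_sum fun j _ => ?_
    rw [← neg_mul]
    exact mul_le_mul_of_nonneg_right (hd1 j) (hc i j).le
  · intro ε hε
    obtain ⟨δ, hδ, hgap⟩ := (hu i).exists_marginal_gap
      (effective_nonneg (hc i) (hE.maximizer.feasible.nonneg i)) (hE.multiplier.hasMarginal i) hε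
    refine ⟨δ, hδ, ?_⟩
    filter_upwards [h.lyapunov_deriv hu hQ hc hE hkq hkp, h.hasMarginal] with t h1 h2 ht hε
    obtain ⟨d, hd, hV⟩ := h1 ht
    have h3 := (gap_term_le_dissipation hu hc hE (h.q_nonneg hkq ht.le) (h2 ht)).1 i
    have h4 := hgap _ (effective_nonneg (hc i) (h.q_nonneg hkq ht.le i)) (h2 ht i) hε
    exact ⟨d, by linarith, hV⟩

lemma IsTrajectory.tendsto_zero_of_inactive (hu : ∀ i, IsUtility (u i)) (hQ : ∀ j, 0 < Q j)
    (hc : ∀ i j, 0 < c i j) (hE : IsEquilibrium u Q c qs ps) (hkq : ∀ i j, 0 < kq i j)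
    (hkp : ∀ j, 0 < kp j) (h : IsTrajectory u Q c kq kp q p) {i : I} {j : J}
    (hij : marginal (u i) (c i) (qs i) j < ps j) :
    Tendsto (fun t => q t i j) atTop (𝓝 0) := by
  obtain ⟨-, l, hl⟩ := h.lyapunov_tendsto hu hQ hc hE hkq hkp
  obtain ⟨K, hK⟩ := h.q_deriv_lower hu hQ hc hE hkq hkp
  refine h.lyapunov_locallyAC.tendsto_zero hl (h.q_ac i j) (K := K i j) ?_ ?_
  · filter_upwards [hK] with t hK ht using hK ht i j
  · intro ε hε
    refine ⟨(ps j - marginal (u i) (c i) (qs i) j) * ε, mul_pos (sub_pos.2 hij) hε, ?_⟩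
    filter_upwards [h.lyapunov_deriv hu hQ hc hE hkq hkp, h.hasMarginal] with t h1 h2 ht hε
    obtain ⟨d, hd, hV⟩ := h1 ht
    have h0 := h.q_nonneg hkq ht.le
    have h3 := (gap_term_le_dissipation hu hc hE h0 (h2 ht)).2.1 i j
    rw [abs_of_nonneg (h0 i j)] at hε
    have h4 := mul_le_mul_of_nonneg_left hε (sub_pos.2 hij).le
    exact ⟨d, by linarith, hV⟩

/-- Demands of decided users converge at an equilibrium with strict complementarity. -/
lemma IsTrajectory.tendsto_demand (hu : ∀ i, IsUtility (u i)) (hQ : ∀ j, 0 < Q j)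
    (hc : ∀ i j, 0 < c i j) (hE : IsEquilibrium u Q c qs ps) (hkq : ∀ i j, 0 < kq i j)
    (hkp : ∀ j, 0 < kp j) (h : IsTrajectory u Q c kq kp q p)
    (hstrict : ∀ i j, qs i j = 0 → marginal (u i) (c i) (qs i) j ≠ ps j) {i : I}
    (hi : IsDecided (qs i)) (j : J) : Tendsto (fun t => q t i j) atTop (𝓝 (qs i j)) := by
  classical
  have hzero : ∀ k, qs i k = 0 → Tendsto (fun t => q t i k) atTop (𝓝 (qs i k)) := by
    intro k hk
    rw [hk]
    exact h.tendsto_zero_of_inactive hu hQ hc hE hkq hkp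
      (lt_of_le_of_ne (by linarith [hE.multiplier.stationary i k]) (hstrict i k hk))
  rcases (hE.maximizer.feasible.nonneg i j).eq_or_lt with h0 | h0
  · exact hzero j h0.symm
  have hother : ∀ k, k ≠ j → qs i k = 0 := by
    intro k hk
    by_contra hne
    exact hk ((Set.ncard_le_one_iff (Set.toFinite _)).1 hi
      (lt_of_le_of_ne (hE.maximizer.feasible.nonneg i k) (Ne.symm hne)) h0)
  -- Solves the definition of `effective` for the single active link; all other demands tend to
  -- zero.
  have key : ∀ r : J → ℝ, r j = (effective (c i) r -
      ∑ k ∈ Finset.univ.erase j, r k * c i k) / c i j := by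
    intro r
    rw [effective, ← Finset.add_sum_erase _ _ (Finset.mem_univ j), add_sub_cancel_right,
      mul_div_cancel_right₀ _ (hc i j).ne']
  rw [key (qs i)]
  refine Tendsto.congr (fun t => (key (q t i)).symm) ?_
  refine ((h.tendsto_effective hu hQ hc hE hkq hkp i).sub ?_).div_const _
  exact tendsto_finsetSum _ fun k hk =>
    (hzero k (hother k (Finset.ne_of_mem_erase hk))).mul_const _

/-- The price of a provider with a decided user converges at an equilibrium with strict
complementarity. -/
lemma IsTrajectory.tendsto_price (hu : ∀ i, IsUtility (u i)) (hQ : ∀ j, 0 < Q j)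
    (hc : ∀ i j, 0 < c i j) (hE : IsEquilibrium u Q c qs ps) (hkq : ∀ i j, 0 < kq i j)
    (hkp : ∀ j, 0 < kp j) (h : IsTrajectory u Q c kq kp q p)
    (hstrict : ∀ i j, qs i j = 0 → marginal (u i) (c i) (qs i) j ≠ ps j) {i : I} {j : J}
    (hi : IsDecided (qs i)) (hij : 0 < qs i j) :
    Tendsto (fun t => p t j) atTop (𝓝 (ps j)) := by
  have hq := h.tendsto_demand hu hQ hc hE hkq hkp hstrict hi j
  obtain ⟨⟨B, hB⟩, -⟩ := h.bounded hu hQ hc hE hkq hkp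
  have hps : marginal (u i) (c i) (qs i) j = ps j :=
    sub_eq_zero.1 ((mul_eq_zero.1 (hE.multiplier.slackness i j)).resolve_left hij.ne')
  rw [← tendsto_sub_nhds_zero_iff]
  -- Once `q_ij` is positive its gate is open, and `f - p = (f - p*) - (p - p*)` has the required
  -- form `w - p`.
  refine LocallyAC.tendsto_zero_of_deriv (y := fun t => q t i j)
    (w := fun t => marginal (u i) (c i) (q t i) j - ps j)
    (K := kp j * (∑ i, B i j + |Q j|)) (hkq i j) (h.q_ac i j) hq
    (.sub (h.p_ac j) (.const _)) ?_ ?_ ?_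
  · filter_upwards [h.p_deriv] with t hp ht
    refine ⟨_, ?_, (hp ht j).sub_const _⟩
    rw [abs_mul, abs_of_pos (hkp j)]
    refine mul_le_mul_of_nonneg_left (abs_gatedPos_le.trans ?_) (hkp j).le
    refine (abs_sub _ _).trans (add_le_add_left ?_ _)
    exact (Finset.abs_sum_le_sum_abs _ _).trans (Finset.sum_le_sum fun i _ => hB t ht.le i j)
  · intro ε hε
    have hcont := (hu i).continuousWithinAt_derivWithin (hE.multiplier.hasMarginal i)
      (effective_nonneg (hc i) (hE.maximizer.feasible.nonneg i))
    have h1 := Metric.tendsto_nhdsWithin_nhds.1 hcont (ε / c i j) (div_pos hε (hc i j))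
    obtain ⟨r, hr, hr'⟩ := h1
    obtain ⟨T, hT⟩ := eventually_atTop.1
      ((h.tendsto_effective hu hQ hc hE hkq hkp i).eventually (Metric.ball_mem_nhds _ hr))
    refine ⟨max T 0, ?_⟩
    filter_upwards [h.hasMarginal] with t hm ht
    obtain ⟨htT, ht0⟩ := max_lt_iff.1 ht
    have h2 := hr' ⟨effective_nonneg (hc i) (h.q_nonneg hkq ht0.le i), hm ht0 i⟩ (hT t htT.le)
    rw [Real.dist_eq, lt_div_iff₀ (hc i j)] at h2
    rw [← hps, marginal, marginal, ← mul_sub, abs_mul, abs_of_pos (hc i j), mul_comm]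
    exact h2
  · obtain ⟨T, hT⟩ := eventually_atTop.1 (hq.eventually (lt_mem_nhds hij))
    refine ⟨max T 0, ?_⟩
    filter_upwards [h.q_deriv] with t hd ht
    obtain ⟨htT, ht0⟩ := max_lt_iff.1 ht
    have h2 := hd ht0 i j
    rw [gatedPos_of_pos (hT t htT.le)] at h2
    convert h2 using 2
    ring

end Dynamics

/-! ### Strict complementarity for generic offsets -/

section Generic

/-- A measurable set whose sections in the direction of one coordinate have at most one point is
almost surely avoided by independent random variables without atoms in that coordinate. -/
lemma ae_notMem_of_subsingleton_sections {Ω ι : Type*} [MeasurableSpace Ω] {P : Measure Ω}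
    [IsProbabilityMeasure P] [Fintype ι] [DecidableEq ι] {X : ι → Ω → ℝ}
    (hX : ∀ i, Measurable (X i)) (hind : iIndepFun X P) (e : ι)
    (hatom : ∀ a, P {ω | X e ω = a} = 0) {B : Set (ι → ℝ)} (hB : MeasurableSet B)
    (hsub : ∀ x a b, Function.update x e a ∈ B → Function.update x e b ∈ B → a = b) :
    ∀ᵐ ω ∂P, (fun i => X i ω) ∉ B := by
  set Y : Ω → (↥(Finset.univ.erase e) → ℝ) := fun ω i => X i ω with hYdef
  have hY : Measurable Y := measurable_pi_iff.2 fun i => hX i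
  have hYX : IndepFun Y (X e) P :=
    (hind.indepFun_finset (Finset.univ.erase e) {e} (by simp) hX).comp
      (φ := id) (ψ := fun f : ↥({e} : Finset ι) → ℝ => f ⟨e, Finset.mem_singleton_self e⟩)
      measurable_id (measurable_pi_apply _)
  -- `g` reassembles the full vector from the other coordinates and the `e`-th; the default `0`
  -- occurs only at `e`, where it is overwritten. By independence the joint law is a product, so
  -- Fubini applies.
  let g : (↥(Finset.univ.erase e) → ℝ) × ℝ → ι → ℝ := fun z =>
    Function.update (fun i => if h : i ∈ Finset.univ.erase e then z.1 ⟨i, h⟩ else 0) e z.2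
  have hg : Measurable g := by
    refine measurable_pi_iff.2 fun i => ?_
    by_cases hi : i = e
    · subst hi
      simpa [g] using measurable_snd
    · have hmem : i ∈ Finset.univ.erase e := by simp [hi]
      simp only [g, Function.update_of_ne hi, dif_pos hmem]
      exact (measurable_pi_apply _).comp measurable_fst
  have hgX : ∀ ω, g (Y ω, X e ω) = fun i => X i ω := by
    intro ω
    funext i
    by_cases hi : i = e
    · subst hi; simp [g]
    · simp [g, hi, hYdef]
  have hmap := hYX.map_prod_eq_prod_map_map hY.aemeasurable (hX e).aemeasurable
  have hnull : P.map (fun ω => (Y ω, X e ω)) (g ⁻¹' B) = 0 := by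
    have : IsProbabilityMeasure (P.map (X e)) := Measure.isProbabilityMeasure_map (hX e).aemeasurable
    rw [hmap, Measure.measure_prod_null (hg hB)]
    refine Eventually.of_forall fun y => ?_
    have hss : (Prod.mk y ⁻¹' (g ⁻¹' B)).Subsingleton := fun a ha b hb => hsub _ a b ha hb
    change P.map (X e) (Prod.mk y ⁻¹' (g ⁻¹' B)) = 0
    rcases hss.eq_empty_or_singleton with h | ⟨a, h⟩
    · rw [h]; simp
    · rw [h, Measure.map_apply (hX e) (measurableSet_singleton a)]
      exact hatom a
  rw [Measure.map_apply (hY.prodMk (hX e)) (hg hB)] at hnull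
  rw [ae_iff]
  simpa [preimage, hgX] using hnull

variable {I J : Type*} [Fintype I] [Fintype J] {u : I → ℝ → ℝ} {Q : J → ℝ}

/-- The optimal social welfare as a function of arbitrary real offsets, the utilities being
extended to negative arguments by constants. -/
noncomputable def maxWelfare (u : I → ℝ → ℝ) (Q : J → ℝ) (c : I → J → ℝ) : ℝ :=
  ⨆ q : {q : I → J → ℝ // IsFeasible Q q}, welfare (fun i x => u i (max x 0)) c q

lemma effective_mono {c c' q : J → ℝ} (hq : ∀ j, 0 ≤ q j) (hc : ∀ j, c j ≤ c' j) :
    effective c q ≤ effective c' q :=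
  Finset.sum_le_sum fun j _ => mul_le_mul_of_nonneg_left (hc j) (hq j)

lemma welfare_mono (hu : ∀ i, IsUtility (u i)) {c c' q : I → J → ℝ} (hq : ∀ i j, 0 ≤ q i j)
    (hc : ∀ i j, c i j ≤ c' i j) :
    welfare (fun i x => u i (max x 0)) c q ≤ welfare (fun i x => u i (max x 0)) c' q :=
  Finset.sum_le_sum fun i _ => (hu i).strictMonoOn.monotoneOn (mem_Ici.2 (le_max_right _ _))
    (mem_Ici.2 (le_max_right _ _)) (max_le_max_right 0 (effective_mono (hq i) (hc i)))

lemma bddAbove_welfare (hu : ∀ i, IsUtility (u i)) (c : I → J → ℝ) :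
    BddAbove (range fun q : {q : I → J → ℝ // IsFeasible Q q} =>
      welfare (fun i x => u i (max x 0)) c q) := by
  refine ⟨∑ i, u i (max (∑ j, Q j * |c i j|) 0), ?_⟩
  rintro _ ⟨⟨q, hq⟩, rfl⟩
  refine Finset.sum_le_sum fun i _ => (hu i).strictMonoOn.monotoneOn (mem_Ici.2 (le_max_right _ _))
    (mem_Ici.2 (le_max_right _ _)) (max_le_max_right 0 (Finset.sum_le_sum fun j _ => ?_))
  have h1 : q i j ≤ Q j := by
    rw [← hq.clearing j]
    exact Finset.single_le_sum (f := fun i => q i j) (fun i _ => hq.nonneg i j) (Finset.mem_univ i)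
  calc q i j * c i j ≤ q i j * |c i j| :=
        mul_le_mul_of_nonneg_left (le_abs_self _) (hq.nonneg i j)
    _ ≤ Q j * |c i j| := mul_le_mul_of_nonneg_right h1 (abs_nonneg _)

lemma welfare_le_maxWelfare (hu : ∀ i, IsUtility (u i)) (c : I → J → ℝ) {q : I → J → ℝ}
    (hq : IsFeasible Q q) : welfare (fun i x => u i (max x 0)) c q ≤ maxWelfare u Q c :=
  le_ciSup (bddAbove_welfare hu c) ⟨q, hq⟩

lemma maxWelfare_mono (hu : ∀ i, IsUtility (u i)) {c c' : I → J → ℝ}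
    (hne : ∃ q : I → J → ℝ, IsFeasible Q q) (hc : ∀ i j, c i j ≤ c' i j) :
    maxWelfare u Q c ≤ maxWelfare u Q c' := by
  obtain ⟨q, hq⟩ := hne
  have : Nonempty {q : I → J → ℝ // IsFeasible Q q} := ⟨⟨q, hq⟩⟩
  exact ciSup_le fun q => (welfare_mono hu q.2.nonneg hc).trans (welfare_le_maxWelfare hu c' q.2)

/-- A supremum of continuous functions, even over an uncountable family, is lower semicontinuous;
this supplies Borel measurability. -/
lemma lowerSemicontinuous_maxWelfare (hu : ∀ i, IsUtility (u i)) :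
    LowerSemicontinuous fun x : I × J → ℝ => maxWelfare u Q fun i j => x (i, j) := by
  refine lowerSemicontinuous_ciSup (fun x => bddAbove_welfare hu _) fun q =>
    Continuous.lowerSemicontinuous ?_
  refine continuous_finsetSum _ fun i _ => ?_
  refine (hu i).continuousOn.comp_continuous ?_ fun x => mem_Ici.2 (le_max_right _ _)
  unfold effective
  fun_prop

lemma welfare_truncated {c q : I → J → ℝ} (hc : ∀ i j, 0 < c i j) (hq : ∀ i j, 0 ≤ q i j) :
    welfare (fun i x => u i (max x 0)) c q = welfare u c q :=
  Finset.sum_congr rfl fun i _ => by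
    beta_reduce
    rw [max_eq_left (effective_nonneg (hc i) (hq i))]

lemma IsSWOMaximizer.maxWelfare_eq (hu : ∀ i, IsUtility (u i)) {c q : I → J → ℝ}
    (hc : ∀ i j, 0 < c i j) (hq : IsSWOMaximizer u Q c q) : maxWelfare u Q c = welfare u c q := by
  have : Nonempty {q : I → J → ℝ // IsFeasible Q q} := ⟨⟨q, hq.feasible⟩⟩
  refine le_antisymm (ciSup_le fun q' => ?_) ?_
  · rw [welfare_truncated hc q'.2.nonneg]
    exact hq.maximal _ q'.2
  · rw [← welfare_truncated hc hq.feasible.nonneg]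
    exact welfare_le_maxWelfare hu c hq.feasible

lemma effective_add_single [DecidableEq J] (c q : J → ℝ) (k : J) (a : ℝ) :
    effective c (fun j => q j + (Pi.single k a : J → ℝ) j) = effective c q + a * c k := by
  simp only [effective, add_mul, Finset.sum_add_distrib]
  congr 1
  rw [Finset.sum_eq_single k]
  · simp
  · intro j _ hj
    simp [hj]
  · simp

/-- If the stationarity condition is tight for an unused link, then improving the offset of that
link strictly improves the optimal welfare. -/
lemma IsEquilibrium.exists_welfare_lt (hu : ∀ i, IsUtility (u i)) (hQ : ∀ j, 0 < Q j)
    {c c' qs : I → J → ℝ} {ps : J → ℝ} (hc : ∀ i j, 0 < c i j)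
    (hE : IsEquilibrium u Q c qs ps) {i₀ : I} {j₀ : J} (h0 : qs i₀ j₀ = 0)
    (heq : marginal (u i₀) (c i₀) (qs i₀) j₀ = ps j₀) (hlt : c i₀ j₀ < c' i₀ j₀)
    (hother : ∀ i j, (i, j) ≠ (i₀, j₀) → c' i j = c i j) :
    ∃ q', IsFeasible Q q' ∧ welfare u c qs < welfare u c' q' := by
  classical
  have hfeas := hE.maximizer.feasible
  obtain ⟨i₁, -, h1⟩ : ∃ i ∈ Finset.univ, 0 < qs i j₀ := by
    by_contra! hcon
    exact absurd (hfeas.clearing j₀ ▸ Finset.sum_nonpos hcon) (not_le.2 (hQ j₀))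
  have hne : i₁ ≠ i₀ := by rintro rfl; linarith
  have heff : ∀ i, effective (c' i) (qs i) = effective (c i) (qs i) := by
    intro i
    refine Finset.sum_congr rfl fun j _ => ?_
    by_cases hij : (i, j) = (i₀, j₀)
    · obtain ⟨rfl, rfl⟩ := Prod.mk.inj hij
      simp [h0]
    · rw [hother i j hij]
  have hc1 : c' i₁ j₀ = c i₁ j₀ := hother _ _ fun h => hne (Prod.mk.inj h).1
  set x₀ := effective (c i₀) (qs i₀) with hx₀
  set x₁ := effective (c i₁) (qs i₁) with hx₁
  have hx₀0 : 0 ≤ x₀ := effective_nonneg (hc i₀) (hfeas.nonneg i₀)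
  have hx₁0 : 0 < x₁ :=
    Finset.sum_pos' (fun j _ => mul_nonneg (hfeas.nonneg i₁ j) (hc i₁ j).le)
      ⟨j₀, Finset.mem_univ _, mul_pos h1 (hc i₁ j₀)⟩
  set U₀ := derivWithin (u i₀) (Ici 0) x₀ with hU₀
  set U₁ := derivWithin (u i₁) (Ici 0) x₁ with hU₁
  have hU₀0 : 0 < U₀ := (hu i₀).derivWithin_pos hx₀0 (hE.multiplier.hasMarginal i₀)
  have hp1 : c i₁ j₀ * U₁ = ps j₀ :=
    sub_eq_zero.1 ((mul_eq_zero.1 (hE.multiplier.slackness i₁ j₀)).resolve_left h1.ne')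
  have hp0 : c i₀ j₀ * U₀ = ps j₀ := heq
  -- Welfare of the two users after moving `ε` units of `j₀` from a buyer `i₁` to `i₀`. Both links
  -- are tight at `c`, so the slope at zero is `U₀ * (c' i₀ j₀ - c i₀ j₀) > 0`. It is one-sided
  -- because `x₀` may be zero.
  set φ : ℝ → ℝ := fun ε => u i₀ (x₀ + ε * c' i₀ j₀) + u i₁ (x₁ - ε * c i₁ j₀) with hφ
  have hs : 0 < c' i₀ j₀ := (hc _ _).trans hlt
  have hder : HasDerivWithinAt φ (U₀ * c' i₀ j₀ + U₁ * -c i₁ j₀) (Ici 0) 0 := by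
    refine HasDerivWithinAt.add ?_ ?_
    · have hd : HasDerivWithinAt (u i₀) U₀ (Ici 0) (x₀ + 0 * c' i₀ j₀) := by
        rw [zero_mul, add_zero]
        exact (hE.multiplier.hasMarginal i₀).hasDerivWithinAt
      refine HasDerivWithinAt.comp (0 : ℝ) hd (h := fun ε => x₀ + ε * c' i₀ j₀) ?_ ?_
      · simpa using (((hasDerivAt_id (0 : ℝ)).mul_const (c' i₀ j₀)).const_add x₀).hasDerivWithinAt
      · intro ε hε
        exact add_nonneg hx₀0 (mul_nonneg hε hs.le)
    · have hd : HasDerivAt (u i₁) U₁ (x₁ - 0 * c i₁ j₀) := by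
        rw [zero_mul, sub_zero]
        exact (hE.multiplier.hasMarginal i₁).hasDerivWithinAt.hasDerivAt
          (Ici_mem_nhds hx₁0)
      refine (HasDerivAt.comp (0 : ℝ) hd (h := fun ε => x₁ - ε * c i₁ j₀) ?_).hasDerivWithinAt
      simpa using ((hasDerivAt_id (0 : ℝ)).mul_const (c i₁ j₀)).const_sub x₁
  have hpos : 0 < U₀ * c' i₀ j₀ + U₁ * -c i₁ j₀ := by nlinarith
  have hslope : ∀ᶠ ε in 𝓝[>] (0 : ℝ), 0 < slope φ 0 ε := by
    have := hasDerivWithinAt_iff_tendsto_slope.1 hder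
    rw [Ici_sdiff_left] at this
    exact this.eventually (lt_mem_nhds hpos)
  obtain ⟨ε, ⟨hε, hε1⟩, hε0⟩ := ((hslope.and (mem_nhdsWithin_of_mem_nhds (Iio_mem_nhds h1))).and
    self_mem_nhdsWithin).exists
  replace hε0 : 0 < ε := hε0
  change ε < qs i₁ j₀ at hε1
  have hinc : φ 0 < φ ε := by
    rw [slope_def_field, sub_zero] at hε
    have := (div_pos_iff_of_pos_right hε0).1 hε
    linarith
  let d : I → ℝ := fun i => if i = i₀ then 1 else if i = i₁ then -1 else 0
  have hd0 : d i₀ = 1 := by simp [d]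
  have hd1 : d i₁ = -1 := by simp [d, hne]
  have hdo : ∀ i, i ≠ i₀ ∧ i ≠ i₁ → d i = 0 := by
    rintro i ⟨h, h'⟩
    simp [d, h, h']
  refine ⟨fun i j => qs i j + (Pi.single j₀ (ε * d i) : J → ℝ) j, ⟨fun i j => ?_, fun j => ?_⟩, ?_⟩
  · have hqn := hfeas.nonneg i j
    by_cases hj : j = j₀
    · subst hj
      rw [Pi.single_eq_same]
      by_cases hi0 : i = i₀
      · subst hi0; rw [hd0]; linarith
      · by_cases hi1 : i = i₁
        · subst hi1; rw [hd1]; linarith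
        · rw [hdo i ⟨hi0, hi1⟩]; linarith
    · rw [Pi.single_eq_of_ne hj]; linarith
  · rw [Finset.sum_add_distrib, hfeas.clearing j, add_eq_left]
    by_cases hj : j = j₀
    · subst hj
      simp only [Pi.single_eq_same]
      rw [← Finset.mul_sum, Fintype.sum_eq_add i₀ i₁ hne.symm hdo, hd0, hd1]
      ring
    · simp [Pi.single_eq_of_ne hj]
  · rw [← sub_pos, welfare, welfare, ← Finset.sum_sub_distrib]
    simp only [effective_add_single, heff]
    rw [Fintype.sum_eq_add i₀ i₁ hne.symm, hd0, hd1, hc1]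
    · simp only [hφ, zero_mul, add_zero, sub_zero] at hinc
      rw [mul_one, mul_neg_one, neg_mul, ← sub_eq_add_neg]
      linarith
    · intro i hi
      rw [hdo i hi]
      simp

/-- Offsets at which the optimal welfare starts to depend on the offset of the link `e`. -/
def criticalOffsets [DecidableEq I] [DecidableEq J] (u : I → ℝ → ℝ) (Q : J → ℝ) (e : I × J) :
    Set (I × J → ℝ) :=
  {x | maxWelfare u Q (fun i j => Function.update x e 0 (i, j)) =
      maxWelfare u Q fun i j => x (i, j)} ∩
    ⋂ n : ℕ, {x | (maxWelfare u Q fun i j => x (i, j)) <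
      maxWelfare u Q fun i j => Function.update x e (x e + 1 / ((n : ℝ) + 1)) (i, j)}

variable [DecidableEq I] [DecidableEq J]

lemma measurableSet_criticalOffsets (hu : ∀ i, IsUtility (u i)) (e : I × J) :
    MeasurableSet (criticalOffsets u Q e) := by
  have hW : Measurable fun x : I × J → ℝ => maxWelfare u Q fun i j => x (i, j) :=
    (lowerSemicontinuous_maxWelfare hu).measurable
  have hupd : ∀ f : (I × J → ℝ) → ℝ, Measurable f →
      Measurable fun x : I × J → ℝ => Function.update x e (f x) := by
    intro f hf
    refine measurable_pi_iff.2 fun k => ?_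
    by_cases hk : k = e
    · subst hk; simpa using hf
    · simpa [hk] using measurable_pi_apply k
  refine (measurableSet_eq_fun (hW.comp (hupd _ measurable_const)) hW).inter
    (MeasurableSet.iInter fun n => measurableSet_lt hW (hW.comp (hupd _ ?_)))
  exact (measurable_pi_apply e).add_const _

/-- If `a < b` were both critical, the welfare would be equal at `a` and `b`, yet by monotonicity
its strict rise just after `a` persists at `b`. -/
lemma criticalOffsets_section (hu : ∀ i, IsUtility (u i))
    (hne : ∃ q : I → J → ℝ, IsFeasible Q q) (e : I × J) (x : I × J → ℝ) (a b : ℝ)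
    (ha : Function.update x e a ∈ criticalOffsets u Q e)
    (hb : Function.update x e b ∈ criticalOffsets u Q e) : a = b := by
  have key : ∀ a b : ℝ, Function.update x e a ∈ criticalOffsets u Q e →
      Function.update x e b ∈ criticalOffsets u Q e → ¬ a < b := by
    rintro a b ⟨ha1, ha2⟩ ⟨hb1, -⟩ hab
    obtain ⟨n, hn⟩ := exists_nat_one_div_lt (sub_pos.2 hab)
    have h1 := mem_iInter.1 ha2 n
    simp only [mem_ofPred_eq, Function.update_idem, Function.update_self] at ha1 hb1 h1
    have h2 : (maxWelfare u Q fun i j => Function.update x e (a + 1 / ((n : ℝ) + 1)) (i, j)) ≤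
        maxWelfare u Q fun i j => Function.update x e b (i, j) := by
      refine maxWelfare_mono hu hne fun i j => ?_
      by_cases hk : (i, j) = e
      · rw [hk, Function.update_self, Function.update_self]; linarith
      · rw [Function.update_of_ne hk, Function.update_of_ne hk]
    linarith
  exact le_antisymm (not_lt.1 (key b a hb ha)) (not_lt.1 (key a b ha hb))

/-- Since the link is unused, `qs` keeps its welfare when the offset drops to zero; since it is
tight, any increase of the offset helps by `exists_welfare_lt`. -/
lemma IsEquilibrium.mem_criticalOffsets (hu : ∀ i, IsUtility (u i)) (hQ : ∀ j, 0 < Q j)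
    {x : I × J → ℝ} {qs : I → J → ℝ} {ps : J → ℝ} (hx : ∀ e, 0 < x e)
    (hE : IsEquilibrium u Q (fun i j => x (i, j)) qs ps) {i₀ : I} {j₀ : J} (h0 : qs i₀ j₀ = 0)
    (heq : marginal (u i₀) (fun j => x (i₀, j)) (qs i₀) j₀ = ps j₀) :
    x ∈ criticalOffsets u Q (i₀, j₀) := by
  have hfeas := hE.maximizer.feasible
  have hW := hE.maximizer.maxWelfare_eq hu fun i j => hx (i, j)
  refine ⟨le_antisymm (maxWelfare_mono hu ⟨_, hfeas⟩ fun i j => ?_) ?_,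
    mem_iInter.2 fun n => ?_⟩
  · by_cases hk : (i, j) = (i₀, j₀)
    · rw [hk, Function.update_self]; exact (hx _).le
    · rw [Function.update_of_ne hk]
  · rw [hW, ← welfare_truncated (fun i j => hx (i, j)) hfeas.nonneg]
    refine le_trans (le_of_eq ?_) (welfare_le_maxWelfare hu _ hfeas)
    refine Finset.sum_congr rfl fun i _ => ?_
    have : effective (fun j => x (i, j)) (qs i) =
        effective (fun j => Function.update x (i₀, j₀) 0 (i, j)) (qs i) := by
      refine Finset.sum_congr rfl fun j _ => ?_
      by_cases hk : (i, j) = (i₀, j₀)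
      · obtain ⟨rfl, rfl⟩ := Prod.mk.inj hk
        simp [h0]
      · beta_reduce
        rw [Function.update_of_ne hk]
    rw [this]
  · have hn : (0 : ℝ) < 1 / ((n : ℝ) + 1) := by positivity
    obtain ⟨q', hq', hlt⟩ := hE.exists_welfare_lt hu hQ (fun i j => hx (i, j)) h0 heq
      (c' := fun i j => Function.update x (i₀, j₀) (x (i₀, j₀) + 1 / ((n : ℝ) + 1)) (i, j))
      (by simpa using hn) fun i j hij => Function.update_of_ne hij _ _
    rw [mem_ofPred_eq, hW]
    refine hlt.trans_le ?_
    rw [← welfare_truncated _ hq'.nonneg]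
    · exact welfare_le_maxWelfare hu _ hq'
    · intro i j
      by_cases hk : (i, j) = (i₀, j₀)
      · rw [hk, Function.update_self]; exact add_pos (hx _) hn
      · rw [Function.update_of_ne hk]; exact hx _

end Generic

/-- Almost surely, complementary slackness is strict at every equilibrium. -/
lemma ae_strict_complementarity {Ω : Type*} [MeasurableSpace Ω] {P : Measure Ω}
    [IsProbabilityMeasure P] {I J : Type*} [Fintype I] [Fintype J] {u : I → ℝ → ℝ}
    (hu : ∀ i, IsUtility (u i)) {Q : J → ℝ} (hQ : ∀ j, 0 < Q j) {c : I → J → Ω → ℝ}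
    (hc_meas : ∀ i j, Measurable (c i j)) (hc_pos : ∀ i j, ∀ᵐ ω ∂P, 0 < c i j ω)
    (hc_indep : iIndepFun (fun e : I × J => c e.1 e.2) P)
    (hc_cont : ∀ i j (a : ℝ), P {ω | c i j ω = a} = 0) :
    ∀ᵐ ω ∂P, ∀ (qs : I → J → ℝ) (ps : J → ℝ), IsEquilibrium u Q (fun i j => c i j ω) qs ps →
      ∀ i j, qs i j = 0 → marginal (u i) (fun j => c i j ω) (qs i) j ≠ ps j := by
  classical
  -- Without feasible demands, as when there are providers but no users, there is no equilibrium.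
  by_cases hne : ∃ q : I → J → ℝ, IsFeasible Q q
  · have h1 : ∀ᵐ ω ∂P, ∀ e : I × J, (fun e : I × J => c e.1 e.2 ω) ∉ criticalOffsets u Q e :=
      ae_all_iff.2 fun e => ae_notMem_of_subsingleton_sections (X := fun e : I × J => c e.1 e.2)
        (fun e => hc_meas _ _) hc_indep e (hc_cont _ _) (measurableSet_criticalOffsets hu e)
        (criticalOffsets_section hu hne e)
    have h2 : ∀ᵐ ω ∂P, ∀ e : I × J, 0 < c e.1 e.2 ω := ae_all_iff.2 fun e => hc_pos _ _
    filter_upwards [h1, h2] with ω h1 h2 qs ps hE i j h0 heq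
    exact h1 (i, j) (IsEquilibrium.mem_criticalOffsets (x := fun e : I × J => c e.1 e.2 ω)
      hu hQ h2 hE h0 heq)
  · exact Eventually.of_forall fun ω qs ps hE => absurd ⟨qs, hE.maximizer.feasible⟩ hne

end ProviderCompetition

end

theorem mainTheorem5 {Ω : Type*} [MeasurableSpace Ω] (P : MeasureTheory.Measure Ω)
    [MeasureTheory.IsProbabilityMeasure P] {I J : Type*} [Fintype I] [Fintype J]
    (u : I → ℝ → ℝ) (hu : ∀ i, ProviderCompetition.IsUtility (u i))
    (Q : J → ℝ) (hQ : ∀ j, 0 < Q j)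
    (c : I → J → Ω → ℝ) (hc_meas : ∀ i j, Measurable (c i j))
    (hc_pos : ∀ i j, ∀ᵐ ω ∂P, 0 < c i j ω)
    (hc_indep : ProbabilityTheory.iIndepFun (fun e : I × J => c e.1 e.2) P)
    (hc_cont : ∀ i j (a : ℝ), P {ω | c i j ω = a} = 0) :
    ∀ᵐ ω ∂P, ∀ (qs : I → J → ℝ) (ps : J → ℝ),
      ProviderCompetition.IsEquilibrium u Q (fun i j => c i j ω) qs ps →
      ∀ (kq : I → J → ℝ) (kp : J → ℝ), (∀ i j, 0 < kq i j) → (∀ j, 0 < kp j) →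
      ∀ (q : ℝ → I → J → ℝ) (p : ℝ → J → ℝ),
        ProviderCompetition.IsTrajectory u Q (fun i j => c i j ω) kq kp q p →
        (∀ i, ProviderCompetition.IsDecided (qs i) →
          Filter.Tendsto (fun t => q t i) Filter.atTop (nhds (qs i))) ∧
        (∀ j, (∃ i, ProviderCompetition.IsDecided (qs i) ∧ 0 < qs i j) →
          Filter.Tendsto (fun t => p t j) Filter.atTop (nhds (ps j))) := by
  have hpos : ∀ᵐ ω ∂P, ∀ i j, 0 < c i j ω :=
    MeasureTheory.ae_all_iff.2 fun i => MeasureTheory.ae_all_iff.2 fun j => hc_pos i j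
  filter_upwards [hpos, ProviderCompetition.ae_strict_complementarity hu hQ hc_meas hc_pos
    hc_indep hc_cont] with ω hc hstrict qs ps hE kq kp hkq hkp q p h
  exact ⟨fun i hi => tendsto_pi_nhds.2 fun j =>
      h.tendsto_demand hu hQ hc hE hkq hkp (hstrict qs ps hE) hi j,
    fun j ⟨i, hi, hij⟩ => h.tendsto_price hu hQ hc hE hkq hkp (hstrict qs ps hE) hi hij⟩
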